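/- Let $d\ge 2$ be an integer. There are constants $\beta>1$ and $c,a,A>0$, depending only on $d$, such that the following holds for all integers $n\ge 2$, all $r\in(0,1)$ with $r\ge(\beta\log n/n)^{1/d}$, and all points $s,t\in[0,1]^d$ with $w:=\|t-s\|>r$. Let $K\ge1$ be the smallest integer with $l:=\frac{w}{4K+1}\le\frac r4$, and put $$W_{\mathrm{ub}}(i)=w\sqrt{1+40^2(d-1)\Bigl(\frac{c\,i}{n\,l\,r^{d-1}}\Bigr)^{\frac2{d-1}}},\qquad i_{\max}=\Bigl\lfloor\frac1c\Bigl(\frac18\sqrt{\frac7{d-1}}\;r\Bigr)^{d-1}nl\Bigr\rfloor .$$ Choose Cartesian coordinates in which $s=(0,\dots,0)$ and $t=(w,0,\dots,0)$, and for $W=W_{\mathrm{ub}}(i)$ let $$\mathrm{BB}(i)=\Bigl[-\frac{W-w}2,\frac{W+w}2\Bigr]\times[-R,R]^{d-1},\qquad R=\frac12\sqrt{W^2-w^2}.$$ Let $G$ be the random weighted unit-disk graph with $n$ vertices, two of which are $s$ and $t$, while the other $n-2$ are independent and uniformly distributed in $[0,1]^d$; two distinct vertices $x,y$ are joined by an edge,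 of length $\|x-y\|$, if and only if $\|x-y\|\le r$. Let $\bar P(i)$ be the probability that the subgraph of $G$ induced by the vertices in $\mathrm{BB}(i)$ contains no $s$–$t$ path of length at most $W_{\mathrm{ub}}(i)$. Then: 1. $i_{\max}=\Theta(nr^d)$, that is, $a\,nr^d\le i_{\max}\le A\,nr^d$; 2. $W_{\mathrm{ub}}(i)=\Theta\Bigl(w\sqrt{1+(i/(nr^d))^{2/(d-1)}}\Bigr)$ for all integers $i\ge1$, with lower and upper constants $a$ and $A$, and $W_{\mathrm{ub}}(i)\le A\,w$ for $1\le i\le i_{\max}$; 3. $\bar P(i)\le e^{-i}$ for all integers $1\le i\le i_{\max}$. -/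

import Mathlib

open MeasureTheory

noncomputable section

namespace UnitDisk

/-- Euclidean `d`-space. -/
abbrev Pt (d : ℕ) := EuclideanSpace ℝ (Fin d)

/-- The unit cube `[0,1]^d`. -/
def unitCube (d : ℕ) : Set (Pt d) := {x | ∀ j, 0 ≤ x j ∧ x j ≤ 1}

/-- The uniform distribution on `[0,1]^d`. -/
def uniformCube (d : ℕ) : Measure (Pt d) :=
  ProbabilityTheory.cond volume (unitCube d)

/-- The law of the `n` vertices of a random weighted unit-disk graph, with the positions `s`, `t`
of the two query vertices `u ≠ v` given: the other `n - 2` vertices are independent and uniform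
in `[0,1]^d`. It is the conditional law of `n` independent uniform points given that the points
number `u` and `v` are `s` and `t`. -/
def vertexLaw {d n : ℕ} (u v : Fin n) (s t : Pt d) : Measure (Fin n → Pt d) :=
  Measure.pi fun k =>
    if k = u then Measure.dirac s else if k = v then Measure.dirac t else uniformCube d

/-- The unit-disk graph with connectivity radius `r` on the points `x 0, …, x (n-1)`. -/
def unitDiskGraph {d n : ℕ} (x : Fin n → Pt d) (r : ℝ) : SimpleGraph (Fin n) where
  Adj a b := a ≠ b ∧ dist (x a) (x b) ≤ r
  symm := ⟨fun _ _ h => ⟨h.1.symm, by rw [dist_comm]; exact h.2⟩⟩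
  loopless := ⟨fun _ h => h.1 rfl⟩

/-- The length of a walk in a graph whose vertices are placed at the points `x`: the sum of the
Euclidean lengths of its edges. -/
def walkLength {d : ℕ} {V : Type} (x : V → Pt d) {G : SimpleGraph V} {a b : V}
    (p : G.Walk a b) : ℝ :=
  (p.darts.map fun e => dist (x e.fst) (x e.snd)).sum

/-- `φ` moves and rotates the coordinate system so that `s` becomes the origin and `t` becomes
`(w, 0, …, 0)`, where `w = ‖t - s‖`. -/
def IsFrame {d : ℕ} (φ : Pt d ≃ᵃⁱ[ℝ] Pt d) (s t : Pt d) : Prop :=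
  φ s = 0 ∧ ∀ j : Fin d, φ t j = if (j : ℕ) = 0 then dist s t else 0

/-- The box `[-(W-w)/2, (W+w)/2] × [-R, R] × ⋯ × [-R, R]` in the coordinates `φ`, where
`R = √(W² - w²) / 2`. -/
def boundingBox {d : ℕ} (φ : Pt d ≃ᵃⁱ[ℝ] Pt d) (w W : ℝ) : Set (Pt d) :=
  {x | ∀ j : Fin d,
    ((j : ℕ) = 0 → φ x j ∈ Set.Icc (-((W - w) / 2)) ((W + w) / 2)) ∧
    ((j : ℕ) ≠ 0 → φ x j ∈ Set.Icc (-(√(W ^ 2 - w ^ 2) / 2)) (√(W ^ 2 - w ^ 2) / 2))}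

/-- The subgraph of the unit-disk graph induced by the vertices in `B` contains a path from the
vertex `u` to the vertex `v` of length at most `W`. -/
def HasShortPath {d n : ℕ} (x : Fin n → Pt d) (r : ℝ) (B : Set (Pt d)) (u v : Fin n) (W : ℝ) :
    Prop :=
  ∃ (hu : u ∈ {k | x k ∈ B}) (hv : v ∈ {k | x k ∈ B})
    (p : ((unitDiskGraph x r).induce {k | x k ∈ B}).Walk ⟨u, hu⟩ ⟨v, hv⟩),
    p.IsPath ∧ walkLength (fun k => x k.1) p ≤ W

/-- The smallest integer `K ≥ 1` with `w / (4K+1) ≤ r / 4`. -/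
def cellCount (w r : ℝ) : ℕ := sInf {K : ℕ | 1 ≤ K ∧ w / (4 * (K : ℝ) + 1) ≤ r / 4}

/-- The length `l = w / (4K+1)`. -/
def cellLength (w r : ℝ) : ℝ := w / (4 * (cellCount w r : ℝ) + 1)

/-- `W_ub(i) = w √(1 + 40² (d-1) (c i / (n l r^(d-1)))^(2/(d-1)))`. -/
def Wub (c : ℝ) (d n : ℕ) (r w : ℝ) (i : ℕ) : ℝ :=
  w * √(1 + 40 ^ 2 * ((d : ℝ) - 1) *
    (c * i / (n * cellLength w r * r ^ (d - 1))) ^ (2 / ((d : ℝ) - 1)))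

/-- `i_max = ⌊(1/c) (√(7/(d-1)) r / 8)^(d-1) n l⌋`. -/
def imax (c : ℝ) (d n : ℕ) (r w : ℝ) : ℕ :=
  ⌊1 / c * (1 / 8 * √(7 / ((d : ℝ) - 1)) * r) ^ (d - 1) * (n * cellLength w r)⌋₊

/-- The probability that the random unit-disk graph, restricted to the bounding box for `W`,
contains no path of length at most `W` between the query vertices. -/
def failProb {d n : ℕ} (r : ℝ) (u v : Fin n) (s t : Pt d) (φ : Pt d ≃ᵃⁱ[ℝ] Pt d) (W : ℝ) :
    ENNReal :=
  vertexLaw u v s t {x | ¬ HasShortPath x r (boundingBox φ (dist s t) W) u v W}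

end UnitDisk

end

namespace UnitDisk

/-! Cut the segment from `s` to `t` into `4K+1` pieces of length `l` and put a cell around every
second one, `2K` cells in all. One vertex in each cell gives a chain whose steps along the axis lie
between `l` and `3l`. A cell of level `m` has half-width `h m`, with `h m ^ (d-1)` proportional to
`i * m / (n * l)`, so it is empty with probability at most `exp (-6im)`.

Emptiness needs volume inside the unit cube, which may cut off most of a cell. A cell of maximal
width still contains a small cube of side proportional to `r` (`ofReal_pow_le_volume_inter_cell`),
and narrower cells follow by contracting towards the axis (`volume_inter_cell_mul_le`).

Give each cell the least level at which it is occupied. A union bound at the top level and Markov's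
inequality for the sum of squared levels show that, outside probability `exp (-i)`, all levels exist
and their squares average at most `3/2` (`measure_not_exists_levels_le`). Since `h m ≤ m * h 1`, the
squared half-widths sum to at most `3K * (h 1)^2`. By Pythagoras the total detour is of order `K *
(h 1)^2 / l`, which the square root in `Wub` covers (`hasShortPath_of_chain`).

The lower bound on `r` makes `imax` exceed a multiple of `log n`, which pays for the union bound
over the cells. -/

/-! ### Choice of levels by Markov's inequality -/

theorem sum_odd_mul_exp_le (i M : ℕ) (hi : 1 ≤ i) :
    ∑ m ∈ Finset.Icc 1 M, (2 * (m : ℝ) + 1) * Real.exp (-(6 * i * m)) ≤ Real.exp (-i) / 4 := by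
  set q : ℝ := Real.exp (-(4 * i)) with hq
  have hi' : (1 : ℝ) ≤ i := by exact_mod_cast hi
  have hq0 : 0 < q := Real.exp_pos _
  have h3 : Real.exp (-3) ≤ 1 / 8 := by
    rw [Real.exp_neg, ← one_div]
    apply one_div_le_one_div_of_le (by norm_num)
    have := Real.quadratic_le_exp_of_nonneg (x := 3) (by norm_num)
    norm_num at this ⊢
    linarith
  have hq1 : q ≤ Real.exp (-i) * (1 / 8) := by
    calc q ≤ Real.exp (-i + -3) := by
          apply Real.exp_le_exp.2; linarith
      _ = Real.exp (-i) * Real.exp (-3) := Real.exp_add _ _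
      _ ≤ _ := by gcongr
  have hq2 : q ≤ 1 / 8 := by
    have : Real.exp (-(i : ℝ)) ≤ 1 := Real.exp_le_one_iff.2 (by linarith)
    nlinarith
  have key : ∀ m ∈ Finset.Icc 1 M,
      (2 * (m : ℝ) + 1) * Real.exp (-(6 * i * m)) ≤ q ^ m := by
    intro m _
    have hm : (0 : ℝ) ≤ m := by positivity
    calc (2 * (m : ℝ) + 1) * Real.exp (-(6 * i * m))
        ≤ Real.exp (2 * m) * Real.exp (-(6 * i * m)) := by
          gcongr
          exact Real.add_one_le_exp _
      _ = Real.exp (2 * m + -(6 * i * m)) := (Real.exp_add _ _).symm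
      _ ≤ Real.exp (m * -(4 * i)) := by
          apply Real.exp_le_exp.2; nlinarith
      _ = q ^ m := by rw [hq, ← Real.exp_nat_mul]
  -- The subtracted term lets the induction close; it needs only `q ≤ 1/2`.
  have geo : ∀ N : ℕ, ∑ m ∈ Finset.Icc 1 N, q ^ m ≤ 2 * q - 2 * (q ^ N * q) := by
    intro N
    induction N with
    | zero => simp
    | succ N ih =>
      rw [Finset.sum_Icc_succ_top (by omega)]
      have : 0 < q ^ N * q := by positivity
      rw [pow_succ]
      nlinarith
  have := Finset.sum_le_sum key
  have h2 := geo M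
  have : 0 < q ^ M * q := by positivity
  linarith

theorem sq_eq_one_add_sum_odd (L : ℕ) (hL : 1 ≤ L) :
    L ^ 2 = 1 + ∑ m ∈ Finset.Ico 1 L, (2 * m + 1) := by
  induction L, hL using Nat.le_induction with
  | base => simp
  | succ L hL ih => rw [Finset.sum_Ico_succ_top hL]; nlinarith

/-- If the events `A j m` have probability at most `exp (-6 i m)`, then outside of an event of
probability at most `exp (-i)` one can choose for each `j` a level `L j` whose event fails, such
that the squares of the levels are at most `3 / 2` on average. No independence is needed. -/
theorem measure_not_exists_levels_le {Ω : Type*} [MeasurableSpace Ω] (P : Measure Ω)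
    (J M i : ℕ) (hi : 1 ≤ i) (hM : 1 ≤ M)
    (A : ℕ → ℕ → Set Ω) (hA : ∀ j m, MeasurableSet (A j m))
    (hP : ∀ j < J, ∀ m, 1 ≤ m → m ≤ M → P (A j m) ≤ ENNReal.ofReal (Real.exp (-(6 * i * m))))
    (hJ : J * Real.exp (-(6 * i * M)) ≤ Real.exp (-i) / 2) :
    P {ω | ¬ ∃ L : ℕ → ℕ, (∀ j < J, 1 ≤ L j ∧ L j ≤ M ∧ ω ∉ A j (L j)) ∧
      2 * ∑ j ∈ Finset.range J, L j ^ 2 ≤ 3 * J} ≤ ENNReal.ofReal (Real.exp (-i)) := by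
  classical
  rcases Nat.eq_zero_or_pos J with rfl | hJpos
  · simp
  -- The weights `2m+1` with `m < L` add up to `L^2 - 1`. Counting every `m ≤ M`, not only those
  -- below the level, makes `f` a sum of indicators, so its expectation needs no independence.
  set f : Ω → ℕ := fun ω => ∑ j ∈ Finset.range J, ∑ m ∈ Finset.Icc 1 M,
    if ω ∈ A j m then 2 * m + 1 else 0 with hf
  set B₁ : Set Ω := ⋃ j ∈ Finset.range J, A j M with hB₁
  set B₂ : Set Ω := {ω | (J : ENNReal) ≤ 2 * (f ω : ENNReal)} with hB₂
  have hsub : {ω | ¬ ∃ L : ℕ → ℕ, (∀ j < J, 1 ≤ L j ∧ L j ≤ M ∧ ω ∉ A j (L j)) ∧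
      2 * ∑ j ∈ Finset.range J, L j ^ 2 ≤ 3 * J} ⊆ B₁ ∪ B₂ := by
    intro ω hω
    by_contra hcon
    apply hω
    simp only [Set.mem_union, not_or, hB₁, hB₂, Set.mem_iUnion, Finset.mem_range, not_exists,
      Set.mem_ofPred_eq, not_le] at hcon
    obtain ⟨h1, h2⟩ := hcon
    have h2' : 2 * f ω < J := by exact_mod_cast h2
    have hex : ∀ j < J, ∃ m, 1 ≤ m ∧ ω ∉ A j m := fun j hj => ⟨M, hM, h1 j hj⟩
    have hch : ∀ j, ∃ L, j < J → (1 ≤ L ∧ L ≤ M ∧ ω ∉ A j L) ∧ ∀ m, 1 ≤ m → m < L → ω ∈ A j m := by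
      intro j
      by_cases hj : j < J
      · refine ⟨Nat.find (hex j hj), fun _ => ⟨⟨(Nat.find_spec (hex j hj)).1,
          Nat.find_min' _ ⟨hM, h1 j hj⟩, (Nat.find_spec (hex j hj)).2⟩, fun m hm hlt => ?_⟩⟩
        have := Nat.find_min (hex j hj) hlt
        by_contra h
        exact this ⟨hm, h⟩
      · exact ⟨0, fun h => absurd h hj⟩
    choose L hL using hch
    refine ⟨L, fun j hj => (hL j hj).1, ?_⟩
    have hle : ∀ j ∈ Finset.range J,
        L j ^ 2 ≤ 1 + ∑ m ∈ Finset.Icc 1 M, if ω ∈ A j m then 2 * m + 1 else 0 := by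
      intro j hj
      obtain ⟨⟨hL1, hLM, _⟩, hmem⟩ := hL j (Finset.mem_range.1 hj)
      rw [sq_eq_one_add_sum_odd _ hL1]
      gcongr
      calc ∑ m ∈ Finset.Ico 1 (L j), (2 * m + 1)
          = ∑ m ∈ Finset.Ico 1 (L j), if ω ∈ A j m then 2 * m + 1 else 0 := by
            apply Finset.sum_congr rfl
            intro m hm
            rw [Finset.mem_Ico] at hm
            rw [if_pos (hmem m hm.1 hm.2)]
        _ ≤ _ := by
            apply Finset.sum_le_sum_of_subset
            intro m hm
            rw [Finset.mem_Ico] at hm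
            rw [Finset.mem_Icc]
            omega
    have := Finset.sum_le_sum hle
    rw [Finset.sum_add_distrib] at this
    simp only [Finset.sum_const, Finset.card_range, smul_eq_mul, mul_one] at this
    change _ ≤ J + f ω at this
    omega
  have hB₁P : P B₁ ≤ ENNReal.ofReal (Real.exp (-i) / 2) := by
    calc P B₁ ≤ ∑ j ∈ Finset.range J, P (A j M) := measure_biUnion_finset_le _ _
      _ ≤ ∑ j ∈ Finset.range J, ENNReal.ofReal (Real.exp (-(6 * i * M))) :=
          Finset.sum_le_sum fun j hj => hP j (Finset.mem_range.1 hj) M hM le_rfl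
      _ = ENNReal.ofReal (J * Real.exp (-(6 * i * M))) := by
          rw [Finset.sum_const, Finset.card_range, nsmul_eq_mul, ENNReal.ofReal_mul (by positivity),
            ENNReal.ofReal_natCast]
      _ ≤ _ := ENNReal.ofReal_le_ofReal hJ
  have hfE : ∀ ω, (f ω : ENNReal) = ∑ j ∈ Finset.range J, ∑ m ∈ Finset.Icc 1 M,
      (A j m).indicator (fun _ => ((2 * m + 1 : ℕ) : ENNReal)) ω := by
    intro ω
    simp only [hf, Nat.cast_sum, Set.indicator_apply]
    refine Finset.sum_congr rfl fun j _ => Finset.sum_congr rfl fun m _ => ?_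
    split_ifs <;> simp
  have hmeas : ∀ j m, Measurable ((A j m).indicator (fun _ : Ω => ((2 * m + 1 : ℕ) : ENNReal))) :=
    fun j m => measurable_const.indicator (hA j m)
  have hfm : Measurable fun ω => (f ω : ENNReal) := by
    simp only [hfE]
    exact Finset.measurable_sum _ fun j _ => Finset.measurable_sum _ fun m _ => hmeas j m
  have hint : ∫⁻ ω, (f ω : ENNReal) ∂P ≤ J * ENNReal.ofReal (Real.exp (-i) / 4) := by
    simp only [hfE]
    rw [lintegral_finsetSum _ fun j _ => Finset.measurable_sum _ fun m _ => hmeas j m]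
    calc _ ≤ ∑ j ∈ Finset.range J, ENNReal.ofReal (Real.exp (-i) / 4) := by
          apply Finset.sum_le_sum
          intro j hj
          rw [lintegral_finsetSum _ fun m _ => hmeas j m]
          calc _ ≤ ∑ m ∈ Finset.Icc 1 M,
                ENNReal.ofReal ((2 * (m : ℝ) + 1) * Real.exp (-(6 * i * m))) := by
                apply Finset.sum_le_sum
                intro m hm
                rw [Finset.mem_Icc] at hm
                rw [lintegral_indicator_const (hA j m), ENNReal.ofReal_mul (by positivity)]
                have : ENNReal.ofReal (2 * (m : ℝ) + 1) = ((2 * m + 1 : ℕ) : ENNReal) := by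
                  rw [← ENNReal.ofReal_natCast]; push_cast; rfl
                rw [this]
                gcongr
                exact hP j (Finset.mem_range.1 hj) m hm.1 hm.2
            _ = ENNReal.ofReal (∑ m ∈ Finset.Icc 1 M,
                  (2 * (m : ℝ) + 1) * Real.exp (-(6 * i * m))) :=
                (ENNReal.ofReal_sum_of_nonneg fun m _ => by positivity).symm
            _ ≤ _ := ENNReal.ofReal_le_ofReal (sum_odd_mul_exp_le i M hi)
      _ = _ := by rw [Finset.sum_const, Finset.card_range, nsmul_eq_mul]
  -- Markov's inequality: the mean of `f` is at most `J * exp (-i) / 4`, the threshold is `J / 2`.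
  have hB₂P : P B₂ ≤ ENNReal.ofReal (Real.exp (-i) / 2) := by
    have hmark := mul_meas_ge_le_lintegral (μ := P) (hfm.const_mul 2) (J : ENNReal)
    rw [lintegral_const_mul _ hfm] at hmark
    have hJ0 : (J : ENNReal) ≠ 0 := by exact_mod_cast hJpos.ne'
    have : (J : ENNReal) * P B₂ ≤ J * ENNReal.ofReal (Real.exp (-i) / 2) := by
      calc _ ≤ 2 * ∫⁻ ω, (f ω : ENNReal) ∂P := hmark
        _ ≤ 2 * (J * ENNReal.ofReal (Real.exp (-i) / 4)) := by gcongr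
        _ = J * (2 * ENNReal.ofReal (Real.exp (-i) / 4)) := by ring
        _ = _ := by
            congr 1
            rw [show (2 : ENNReal) = ENNReal.ofReal 2 by simp, ← ENNReal.ofReal_mul (by norm_num)]
            congr 1
            ring
    exact (ENNReal.mul_le_mul_iff_right hJ0 (ENNReal.natCast_ne_top J)).1 this
  calc _ ≤ P (B₁ ∪ B₂) := measure_mono hsub
    _ ≤ P B₁ + P B₂ := measure_union_le _ _
    _ ≤ ENNReal.ofReal (Real.exp (-i) / 2) + ENNReal.ofReal (Real.exp (-i) / 2) := by gcongr
    _ = ENNReal.ofReal (Real.exp (-i)) := by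
        rw [← ENNReal.ofReal_add (by positivity) (by positivity), add_halves]

/-! ### Volume of a cell inside the unit cube -/

theorem measurePreserving_affineIsometryEquiv {d : ℕ} (φ : Pt d ≃ᵃⁱ[ℝ] Pt d) :
    MeasurePreserving φ volume volume := by
  have h : (φ : Pt d → Pt d) = (fun x => x + φ 0) ∘ φ.linearIsometryEquiv := by
    funext x
    have := φ.map_vadd 0 x
    simpa using this
  rw [h]
  exact (measurePreserving_add_right volume (φ 0)).comp φ.linearIsometryEquiv.measurePreserving

theorem volume_image_affineIsometryEquiv {d : ℕ} (φ : Pt d ≃ᵃⁱ[ℝ] Pt d) (S : Set (Pt d)) :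
    volume (φ '' S) = volume S := by
  have h := (measurePreserving_affineIsometryEquiv φ).measure_preimage_emb
    φ.toHomeomorph.measurableEmbedding (φ '' S)
  rw [← h, Set.preimage_image_eq _ φ.injective]

theorem volume_box {d : ℕ} (a b : Fin d → ℝ) :
    volume {x : Pt d | ∀ j, a j ≤ x j ∧ x j ≤ b j} = ∏ j, ENNReal.ofReal (b j - a j) := by
  rw [← Real.volume_Icc_pi, ← (PiLp.volume_preserving_ofLp (Fin d)).measure_preimage
    measurableSet_Icc.nullMeasurableSet]
  congr 1
  ext x
  simp [Pi.le_def, forall_and]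

theorem volume_unitCube (d : ℕ) : volume (unitCube d) = 1 := by
  have := volume_box (d := d) (fun _ => 0) (fun _ => 1)
  simpa [unitCube] using this

theorem measurableSet_unitCube (d : ℕ) : MeasurableSet (unitCube d) := by
  apply IsClosed.measurableSet
  simp only [unitCube, Set.ofPred_forall, Set.ofPred_and]
  refine isClosed_iInter fun j => IsClosed.inter ?_ ?_
  · exact isClosed_le continuous_const (by fun_prop)
  · exact isClosed_le (by fun_prop) continuous_const

theorem convex_unitCube (d : ℕ) : Convex ℝ (unitCube d) := by
  intro x hx y hy a b ha hb hab j
  have h1 := hx j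
  have h2 := hy j
  simp only [PiLp.add_apply, PiLp.smul_apply, smul_eq_mul]
  constructor
  · nlinarith
  · nlinarith

instance isProbabilityMeasure_uniformCube (d : ℕ) : IsProbabilityMeasure (uniformCube d) := by
  apply ProbabilityTheory.cond_isProbabilityMeasure_of_finite <;> simp [volume_unitCube]

theorem uniformCube_apply {d : ℕ} (D : Set (Pt d)) :
    uniformCube d D = volume (unitCube d ∩ D) := by
  rw [uniformCube, ProbabilityTheory.cond_apply (measurableSet_unitCube d), volume_unitCube]
  simp

/-- Stretching all coordinates but the first by the factor `a`. -/
noncomputable def stretch (d : ℕ) (a : ℝ) : Pt d →ₗ[ℝ] Pt d where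
  toFun x := WithLp.toLp 2 fun j => (if (j : ℕ) = 0 then 1 else a) * x j
  map_add' x y := by ext j; simp [mul_add]
  map_smul' k x := by ext j; simp [mul_left_comm]

@[simp] theorem stretch_apply {d : ℕ} (a : ℝ) (x : Pt d) (j : Fin d) :
    stretch d a x j = (if (j : ℕ) = 0 then 1 else a) * x j := rfl

theorem det_stretch {d : ℕ} (hd : 1 ≤ d) (a : ℝ) : LinearMap.det (stretch d a) = a ^ (d - 1) := by
  rw [← LinearMap.det_toMatrix (EuclideanSpace.basisFun (Fin d) ℝ).toBasis]
  have : LinearMap.toMatrix (EuclideanSpace.basisFun (Fin d) ℝ).toBasis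
      (EuclideanSpace.basisFun (Fin d) ℝ).toBasis (stretch d a) =
      Matrix.diagonal fun j : Fin d => if (j : ℕ) = 0 then 1 else a := by
    ext i j
    rw [LinearMap.toMatrix_apply]
    by_cases h : i = j
    · subst h; simp
    · simp [h]
  rw [this, Matrix.det_diagonal]
  obtain ⟨e, rfl⟩ := Nat.exists_eq_add_of_le' hd
  rw [Fin.prod_univ_succ]
  simp

/-- The points whose first coordinate in the frame `φ` lies in `[lo, hi]`, while the others are at
most `h` in absolute value. -/
def cell {d : ℕ} (φ : Pt d ≃ᵃⁱ[ℝ] Pt d) (lo hi h : ℝ) : Set (Pt d) :=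
  {x | ∀ j : Fin d, ((j : ℕ) = 0 → φ x j ∈ Set.Icc lo hi) ∧ ((j : ℕ) ≠ 0 → |φ x j| ≤ h)}

theorem measurableSet_cell {d : ℕ} (φ : Pt d ≃ᵃⁱ[ℝ] Pt d) (lo hi h : ℝ) :
    MeasurableSet (cell φ lo hi h) := by
  have hc : ∀ j : Fin d, Continuous fun x => φ x j := fun j => by
    have := φ.continuous
    fun_prop
  apply IsClosed.measurableSet
  simp only [cell, Set.ofPred_forall, Set.ofPred_and]
  refine isClosed_iInter fun j => IsClosed.inter ?_ ?_
  · exact isClosed_iInter fun _ => isClosed_Icc.preimage (hc j)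
  · exact isClosed_iInter fun _ => isClosed_le (hc j).abs continuous_const

/-- The point of the line through `s` and `t` at distance `ξ` from `s`. -/
noncomputable def linePoint {d : ℕ} (s t : Pt d) (ξ : ℝ) : Pt d :=
  AffineMap.lineMap s t (ξ / dist s t)

theorem frame_linePoint {d : ℕ} {φ : Pt d ≃ᵃⁱ[ℝ] Pt d} {s t : Pt d} (hφ : IsFrame φ s t)
    (hst : 0 < dist s t) (ξ : ℝ) (j : Fin d) :
    φ (linePoint s t ξ) j = if (j : ℕ) = 0 then ξ else 0 := by
  have h : φ (linePoint s t ξ) = AffineMap.lineMap (φ s) (φ t) (ξ / dist s t) :=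
    φ.toAffineEquiv.toAffineMap.apply_lineMap s t _
  rw [h, hφ.1]
  simp only [AffineMap.lineMap_apply, vsub_eq_sub, sub_zero, vadd_eq_add, add_zero,
    PiLp.smul_apply, smul_eq_mul, hφ.2 j]
  split_ifs
  · field_simp
  · simp

theorem linePoint_mem_unitCube {d : ℕ} {s t : Pt d} (hs : s ∈ unitCube d) (ht : t ∈ unitCube d)
    {ξ : ℝ} (h0 : 0 ≤ ξ) (h1 : ξ ≤ dist s t) : linePoint s t ξ ∈ unitCube d := by
  apply (convex_unitCube d).lineMap_mem hs ht
  exact ⟨by positivity, div_le_one_of_le₀ h1 dist_nonneg⟩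

/-- Contracting towards the axis by `a` has determinant `a ^ (d-1)`. It moves a point along the line
to its projection on the axis; that projection lies on the segment from `s` to `t`, so by convexity
the image stays in the cube. -/
theorem volume_inter_cell_mul_le {d : ℕ} (hd : 1 ≤ d) {φ : Pt d ≃ᵃⁱ[ℝ] Pt d} {s t : Pt d}
    (hs : s ∈ unitCube d) (ht : t ∈ unitCube d) (hφ : IsFrame φ s t) (hst : 0 < dist s t)
    {lo hi h a : ℝ} (hlo : 0 ≤ lo) (hhi : hi ≤ dist s t) (ha0 : 0 ≤ a) (ha1 : a ≤ 1) :
    ENNReal.ofReal (a ^ (d - 1)) * volume (unitCube d ∩ cell φ lo hi h)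
      ≤ volume (unitCube d ∩ cell φ lo hi (a * h)) := by
  set S := unitCube d ∩ cell φ lo hi h with hS
  have h1 : volume (φ.symm '' (stretch d a '' (φ '' S)))
      = ENNReal.ofReal (a ^ (d - 1)) * volume S := by
    rw [volume_image_affineIsometryEquiv, Measure.addHaar_image_linearMap,
      volume_image_affineIsometryEquiv, det_stretch hd, abs_of_nonneg (by positivity)]
  rw [← h1]
  apply measure_mono
  rintro _ ⟨_, ⟨_, ⟨x, ⟨hxC, hxD⟩, rfl⟩, rfl⟩, rfl⟩
  constructor
  · let z : Fin d := ⟨0, hd⟩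
    have hz := (hxD z).1 rfl
    have hmem := (convex_unitCube d).lineMap_mem
      (linePoint_mem_unitCube hs ht (hlo.trans hz.1) (hz.2.trans hhi)) hxC ⟨ha0, ha1⟩
    convert hmem using 1
    rw [← φ.injective.eq_iff, φ.apply_symm_apply]
    have h : φ (AffineMap.lineMap (linePoint s t (φ x z)) x a)
        = AffineMap.lineMap (φ (linePoint s t (φ x z))) (φ x) a :=
      φ.toAffineEquiv.toAffineMap.apply_lineMap _ _ _
    rw [h]
    ext j
    simp only [stretch_apply, AffineMap.lineMap_apply, vsub_eq_sub, vadd_eq_add, PiLp.add_apply,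
      PiLp.smul_apply, PiLp.sub_apply, smul_eq_mul, frame_linePoint hφ hst]
    split_ifs with hj
    · have : j = z := Fin.ext hj
      rw [this]; ring
    · ring
  · intro j
    rw [φ.apply_symm_apply, stretch_apply]
    refine ⟨fun hj => ?_, fun hj => ?_⟩
    · rw [if_pos hj, one_mul]; exact (hxD j).1 hj
    · rw [if_neg hj, abs_mul, abs_of_nonneg ha0]
      exact mul_le_mul_of_nonneg_left ((hxD j).2 hj) ha0

theorem abs_sub_apply_le_dist {d : ℕ} (x y : Pt d) (j : Fin d) : |x j - y j| ≤ dist x y := by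
  rw [dist_eq_norm]
  exact PiLp.norm_apply_le (x - y) j

theorem ofReal_pow_le_volume_inter_cell {d : ℕ} {φ : Pt d ≃ᵃⁱ[ℝ] Pt d} {s t : Pt d}
    (hs : s ∈ unitCube d) (ht : t ∈ unitCube d) (hφ : IsFrame φ s t) (hst : 0 < dist s t)
    {lo hi h η : ℝ} (hlo : 0 ≤ lo) (hhi : hi ≤ dist s t) (hη0 : 0 ≤ η) (hη1 : η ≤ 1 / 2)
    (hle : 2 * (√d * η) ≤ hi - lo) (hh : √d * η ≤ h) :
    ENNReal.ofReal (η ^ d) ≤ volume (unitCube d ∩ cell φ lo hi h) := by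
  have hdη : 0 ≤ √d * η := by positivity
  set p := linePoint s t ((lo + hi) / 2) with hp
  have hpC : p ∈ unitCube d := linePoint_mem_unitCube hs ht (by linarith) (by linarith)
  -- In each coordinate the small cube extends from `p` towards the middle of `[0,1]`, so it stays
  -- in the unit cube. It has diameter `√d * η`, whence it fits in the cell whatever the rotation
  -- `φ`.
  set α : Fin d → ℝ := fun j => if p j ≤ 1 / 2 then p j else p j - η with hα
  have hvol := volume_box α (fun j => α j + η)
  have : ∏ j : Fin d, ENNReal.ofReal ((fun j => α j + η) j - α j) = ENNReal.ofReal (η ^ d) := by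
    simp [ENNReal.ofReal_pow hη0]
  rw [← this, ← hvol]
  apply measure_mono
  intro x hx
  have hαp : ∀ j, 0 ≤ α j ∧ α j + η ≤ 1 ∧ α j ≤ p j ∧ p j ≤ α j + η := by
    intro j
    have := hpC j
    simp only [hα]
    split_ifs <;> refine ⟨?_, ?_, ?_, ?_⟩ <;> linarith
  refine ⟨fun j => ⟨(hαp j).1.trans (hx j).1, (hx j).2.trans (hαp j).2.1⟩, ?_⟩
  have hdist : dist x p ≤ √d * η := by
    rw [EuclideanSpace.dist_eq]
    apply Real.sqrt_le_iff.2 ⟨hdη, ?_⟩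
    rw [mul_pow, Real.sq_sqrt (by positivity)]
    calc ∑ j, dist (x j) (p j) ^ 2 ≤ ∑ _j : Fin d, η ^ 2 := by
          apply Finset.sum_le_sum
          intro j _
          have h1 := hx j
          have h2 := hαp j
          have : dist (x j) (p j) ≤ η := by
            rw [Real.dist_eq, abs_le]; constructor <;> linarith
          gcongr
      _ = _ := by simp
  have hφd : ∀ j, |φ x j - φ p j| ≤ √d * η := fun j =>
    (abs_sub_apply_le_dist _ _ j).trans (by rw [φ.dist_map]; exact hdist)
  intro j
  have h1 := hφd j
  rw [hp, frame_linePoint hφ hst] at h1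
  refine ⟨fun hj => ?_, fun hj => ?_⟩
  · rw [if_pos hj, abs_le] at h1
    constructor <;> linarith
  · rw [if_neg hj, sub_zero] at h1
    exact h1.trans hh

/-! ### Probability that a cell is empty -/

section vertexLaw

variable {d n : ℕ}

theorem isProbabilityMeasure_vertexLaw_component (u v : Fin n) (s t : Pt d) (k : Fin n) :
    IsProbabilityMeasure
      (if k = u then Measure.dirac s else if k = v then Measure.dirac t else uniformCube d) := by
  split_ifs <;> infer_instance

theorem vertexLaw_ne_left (u v : Fin n) (s t : Pt d) : vertexLaw u v s t {x | x u ≠ s} = 0 := by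
  have := isProbabilityMeasure_vertexLaw_component u v s t
  have h : {x : Fin n → Pt d | x u ≠ s} =
      Set.univ.pi fun k => if k = u then {s}ᶜ else Set.univ := by
    ext x
    simp only [Set.mem_ofPred_eq, Set.mem_pi, Set.mem_univ, true_imp_iff]
    refine ⟨fun h k => ?_, fun h => by simpa using h u⟩
    split_ifs with hk
    · subst hk; exact h
    · trivial
  rw [vertexLaw, h, Measure.pi_pi]
  apply Finset.prod_eq_zero (Finset.mem_univ u)
  simp

theorem vertexLaw_ne_right (u v : Fin n) (huv : u ≠ v) (s t : Pt d) :
    vertexLaw u v s t {x | x v ≠ t} = 0 := by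
  have := isProbabilityMeasure_vertexLaw_component u v s t
  have h : {x : Fin n → Pt d | x v ≠ t} =
      Set.univ.pi fun k => if k = v then {t}ᶜ else Set.univ := by
    ext x
    simp only [Set.mem_ofPred_eq, Set.mem_pi, Set.mem_univ, true_imp_iff]
    refine ⟨fun h k => ?_, fun h => by simpa using h v⟩
    split_ifs with hk
    · subst hk; exact h
    · trivial
  rw [vertexLaw, h, Measure.pi_pi]
  apply Finset.prod_eq_zero (Finset.mem_univ v)
  simp [huv.symm]

/-- The event that none of the random vertices lies in `D`. -/
def avoids (u v : Fin n) (D : Set (Pt d)) : Set (Fin n → Pt d) :=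
  {x | ∀ k, k ≠ u → k ≠ v → x k ∉ D}

theorem measurableSet_avoids (u v : Fin n) {D : Set (Pt d)} (hD : MeasurableSet D) :
    MeasurableSet (avoids u v D) := by
  simp only [avoids, Set.ofPred_forall]
  refine MeasurableSet.iInter fun k => MeasurableSet.iInter fun _ => MeasurableSet.iInter fun _ => ?_
  exact hD.compl.preimage (measurable_pi_apply k)

/-- The event is a product set, unconstrained at `u` and `v`; the other `n - 2` factors are at most
`1 - p ≤ exp (-p)`. -/
theorem vertexLaw_avoids_le (u v : Fin n) (huv : u ≠ v) (s t : Pt d) {D : Set (Pt d)}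
    (hD : MeasurableSet D) {p : ℝ} (hp0 : 0 ≤ p) (hp : ENNReal.ofReal p ≤ uniformCube d D) :
    vertexLaw u v s t (avoids u v D) ≤ ENNReal.ofReal (Real.exp (-(((n : ℝ) - 2) * p))) := by
  have := isProbabilityMeasure_vertexLaw_component u v s t
  have h : avoids u v D = Set.univ.pi fun k => if k = u ∨ k = v then Set.univ else Dᶜ := by
    ext x
    simp only [avoids, Set.mem_ofPred_eq, Set.mem_pi, Set.mem_univ, true_imp_iff]
    refine forall_congr' fun k => ?_
    split_ifs with hk
    · simp only [Set.mem_univ, iff_true]; tauto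
    · simp only [Set.mem_compl_iff]; tauto
  have hcard : n - 2 = (Finset.univ.filter fun k : Fin n => ¬ (k = u ∨ k = v)).card := by
    rw [Finset.filter_not, Finset.card_sdiff_of_subset (Finset.filter_subset _ _), Finset.filter_or,
      Finset.filter_eq' _ u, Finset.filter_eq' _ v]
    simp [huv]
  have hn : 2 ≤ n := by
    have hu := u.2
    have hv := v.2
    have : (u : ℕ) ≠ v := fun h => huv (Fin.ext h)
    omega
  have hle : uniformCube d Dᶜ ≤ ENNReal.ofReal (Real.exp (-p)) := by
    rw [prob_compl_eq_one_sub hD]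
    calc 1 - uniformCube d D ≤ 1 - ENNReal.ofReal p := tsub_le_tsub_left hp 1
      _ = ENNReal.ofReal (1 - p) := by rw [ENNReal.ofReal_sub _ hp0, ENNReal.ofReal_one]
      _ ≤ _ := ENNReal.ofReal_le_ofReal (Real.one_sub_le_exp_neg p)
  rw [vertexLaw, h, Measure.pi_pi]
  calc _ = ∏ k : Fin n, if ¬ (k = u ∨ k = v) then uniformCube d Dᶜ else 1 := by
        apply Finset.prod_congr rfl
        intro k _
        by_cases hu : k = u
        · simp [hu]
        · by_cases hv : k = v
          · simp [hv, huv.symm]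
          · simp [hu, hv]
    _ = uniformCube d Dᶜ ^ (n - 2) := by
        rw [← Finset.prod_filter, Finset.prod_const, hcard]
    _ ≤ ENNReal.ofReal (Real.exp (-p)) ^ (n - 2) := by gcongr
    _ = _ := by
        rw [← ENNReal.ofReal_pow (by positivity), ← Real.exp_nat_mul, Nat.cast_sub hn]
        congr 2
        push_cast
        ring

end vertexLaw

/-! ### From a chain of occupied cells to a short path -/

theorem exists_walk_of_adj {V : Type} {G : SimpleGraph V} {d : ℕ} (x : V → Pt d) (P : ℕ → V)
    (N : ℕ) (hadj : ∀ k < N, G.Adj (P k) (P (k + 1))) :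
    ∃ p : G.Walk (P 0) (P N), p.support = (List.range (N + 1)).map P ∧
      walkLength x p = ∑ k ∈ Finset.range N, dist (x (P k)) (x (P (k + 1))) := by
  induction N with
  | zero => exact ⟨SimpleGraph.Walk.nil, by simp, by simp [walkLength]⟩
  | succ N ih =>
    obtain ⟨p, hp, hl⟩ := ih fun k hk => hadj k (by omega)
    refine ⟨p.concat (hadj N (by omega)), ?_, ?_⟩
    · rw [SimpleGraph.Walk.support_concat, hp, List.range_succ (n := N + 1)]
      simp
    · rw [Finset.sum_range_succ, ← hl]
      simp [walkLength, SimpleGraph.Walk.darts_concat]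

/-- The distance of two points of Euclidean space, from a bound on the differences of their
coordinates. -/
theorem dist_sq_le_of_coord {d : ℕ} (hd : 1 ≤ d) {p q : Pt d} {H₁ H₂ : ℝ}
    (hp : ∀ j : Fin d, (j : ℕ) ≠ 0 → |p j| ≤ H₁) (hq : ∀ j : Fin d, (j : ℕ) ≠ 0 → |q j| ≤ H₂) :
    dist p q ^ 2 ≤ (q ⟨0, hd⟩ - p ⟨0, hd⟩) ^ 2 + ((d : ℝ) - 1) * (H₁ + H₂) ^ 2 := by
  obtain ⟨e, rfl⟩ := Nat.exists_eq_add_of_le' hd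
  rw [EuclideanSpace.dist_eq, Real.sq_sqrt (Finset.sum_nonneg fun _ _ => sq_nonneg _),
    Fin.sum_univ_succ]
  apply add_le_add
  · rw [Real.dist_eq, sq_abs]
    exact le_of_eq (by rw [← neg_sq]; congr 1; simp)
  · calc _ ≤ ∑ _j : Fin e, (H₁ + H₂) ^ 2 := by
          apply Finset.sum_le_sum
          intro j _
          have h1 := hp j.succ (by simp)
          have h2 := hq j.succ (by simp)
          have : dist (p j.succ) (q j.succ) ≤ H₁ + H₂ := by
            rw [Real.dist_eq]
            exact (abs_sub _ _).trans (add_le_add h1 h2)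
          gcongr
      _ = _ := by simp

/-- Squaring leaves `10000 z² ≤ 1400 z`, true up to `z = 0.14`. -/
theorem one_add_le_sqrt {z : ℝ} (h0 : 0 ≤ z) (h1 : z ≤ 7 / 64) :
    1 + 100 * z ≤ √(1 + 1600 * z) := by
  apply Real.le_sqrt_of_sq_le
  nlinarith

theorem sum_add_sq_le (H : ℕ → ℝ) (N : ℕ) (h0 : H 0 = 0) (hN : H (N + 1) = 0) :
    ∑ k ∈ Finset.range (N + 1), (H k + H (k + 1)) ^ 2
      ≤ 4 * ∑ k ∈ Finset.range N, H (k + 1) ^ 2 := by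
  calc _ ≤ ∑ k ∈ Finset.range (N + 1), (2 * H k ^ 2 + 2 * H (k + 1) ^ 2) := by
        apply Finset.sum_le_sum
        intro k _
        nlinarith [sq_nonneg (H k - H (k + 1))]
    _ = _ := by
        rw [Finset.sum_add_distrib, Finset.sum_range_succ', Finset.sum_range_succ (n := N), h0, hN,
          ← Finset.mul_sum]
        ring

/-- Keeps the chain in the box: one vertex may use up the whole budget `3K * h^2`, but the squared
radius of the box grows like `w²`, hence at least like `K² r²`. -/
theorem four_mul_sq_le {r l w K z h H : ℝ} (hr : 0 < r) (hl : 5 * r / 36 ≤ l)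
    (hw : w = (4 * K + 1) * l) (hK : 1 ≤ K) (hz : 0 ≤ z) (hh : h ^ 2 ≤ z * r ^ 2)
    (hH : H ^ 2 ≤ 3 * K * h ^ 2) : (H * 2) ^ 2 ≤ w ^ 2 * (1600 * z) := by
  have hKr : 0 < K * r := by positivity
  have hw' : 5 / 9 * (K * r) ≤ w := by rw [hw]; nlinarith
  have h1 : (5 / 9 * (K * r)) ^ 2 ≤ w ^ 2 := pow_le_pow_left₀ (by positivity) hw' 2
  have h2 : K * r ^ 2 ≤ (K * r) ^ 2 := by
    rw [mul_pow]
    have : K ≤ K ^ 2 := by nlinarith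
    gcongr
  have h3 : 3 * K * h ^ 2 ≤ 3 * K * (z * r ^ 2) := by gcongr
  have h4 : z * (12 * (K * r ^ 2)) ≤ z * (1600 * w ^ 2) := by
    apply mul_le_mul_of_nonneg_left _ hz
    have : 0 < (K * r) ^ 2 := by positivity
    linarith
  linarith

theorem excess_le {r l K z : ℝ} (hr : 0 < r) (hl : 5 * r / 36 ≤ l) (hK : 0 ≤ K) (hz : 0 ≤ z) :
    6 * K * z * r ^ 2 ≤ (4 * K + 1) * l * (100 * z) * l := by
  have h0 : (5 * r / 36) ^ 2 ≤ l ^ 2 := pow_le_pow_left₀ (by positivity) hl 2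
  have h1 : 6 * r ^ 2 ≤ 400 * l ^ 2 := by nlinarith [sq_nonneg r]
  have h2 := mul_le_mul_of_nonneg_left h1 (show 0 ≤ z * K by positivity)
  have h3 : 0 ≤ z * l ^ 2 := by positivity
  linarith

/-- Pythagoras linearised: `√(g² + y) ≤ g + y / (2g)`, and `g ≥ l`. -/
theorem le_add_div_of_sq_le {D g y l : ℝ} (hl : 0 < l) (hg : l ≤ g) (hy : 0 ≤ y) (hD : 0 ≤ D)
    (h : D ^ 2 ≤ g ^ 2 + y) : D ≤ g + y / (2 * l) := by
  have hq : 0 ≤ y / (2 * l) := by positivity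
  have hyq : y = 2 * l * (y / (2 * l)) := by field_simp
  set q := y / (2 * l)
  apply (pow_le_pow_iff_left₀ hD (by linarith) two_ne_zero).1
  nlinarith [mul_le_mul_of_nonneg_right hg hq, sq_nonneg q]

/-- A chain of vertices, one in each of the successive cells, is a short path. -/
theorem hasShortPath_of_chain {d n : ℕ} (hd : 2 ≤ d) {x : Fin n → Pt d} {r l h w W : ℝ}
    {φ : Pt d ≃ᵃⁱ[ℝ] Pt d} {K : ℕ} (P : ℕ → Fin n) (H : ℕ → ℝ) (hK : 1 ≤ K)
    (hr : 0 < r) (hl1 : 5 * r / 36 ≤ l) (hl2 : l ≤ r / 4) (hw : w = (4 * K + 1) * l)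
    (hW : W = w * √(1 + 1600 * (((d : ℝ) - 1) * (h / r) ^ 2)))
    (hz : ((d : ℝ) - 1) * (h / r) ^ 2 ≤ 7 / 64)
    (hcell : ∀ k ≤ 2 * K + 1, x (P k) ∈ cell φ ((2 * k - 1) * l) (2 * k * l) (H k))
    (hfirst : ∀ j : Fin d, (j : ℕ) = 0 → φ (x (P 0)) j = 0)
    (hlast : ∀ j : Fin d, (j : ℕ) = 0 → φ (x (P (2 * K + 1))) j = w)
    (hH0 : H 0 = 0) (hHN : H (2 * K + 1) = 0)
    (hHr : ∀ k ≤ 2 * K + 1, ((d : ℝ) - 1) * H k ^ 2 ≤ 7 / 64 * r ^ 2)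
    (hsum : ∑ k ∈ Finset.range (2 * K), H (k + 1) ^ 2 ≤ 3 * K * h ^ 2) :
    HasShortPath x r (boundingBox φ w W) (P 0) (P (2 * K + 1)) W := by
  have hd1 : (1 : ℝ) ≤ (d : ℝ) - 1 := by
    have : (2 : ℝ) ≤ d := by exact_mod_cast hd
    linarith
  have hK' : (1 : ℝ) ≤ K := by exact_mod_cast hK
  have hl : 0 < l := by linarith
  have hw0 : 0 < w := by rw [hw]; positivity
  set z := ((d : ℝ) - 1) * (h / r) ^ 2 with hzdef
  have hz0 : 0 ≤ z := by positivity
  have hhz : ((d : ℝ) - 1) * h ^ 2 = z * r ^ 2 := by rw [hzdef]; field_simp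
  have hWge : w * (1 + 100 * z) ≤ W := by
    rw [hW]
    exact mul_le_mul_of_nonneg_left (one_add_le_sqrt hz0 hz) hw0.le
  have hWw : w ≤ W := by nlinarith [mul_nonneg hw0.le hz0]
  have hWsq : W ^ 2 - w ^ 2 = w ^ 2 * (1600 * z) := by
    rw [hW, mul_pow, Real.sq_sqrt (by positivity)]; ring
  let o : Fin d := ⟨0, by omega⟩
  set ξ : ℕ → ℝ := fun k => φ (x (P k)) o with hξ
  -- The endpoints count as cells `0` and `2K+1` of height zero: one at the right end of `[-l, 0]`,
  -- the other at the left end `(4K+1) l = w` of the last.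
  have hξc : ∀ k ≤ 2 * K + 1, (2 * k - 1) * l ≤ ξ k ∧ ξ k ≤ 2 * k * l := fun k hk =>
    (hcell k hk o).1 rfl
  have hgap : ∀ k < 2 * K + 1, l ≤ ξ (k + 1) - ξ k ∧ ξ (k + 1) - ξ k ≤ 3 * l := by
    intro k hk
    have h1 := hξc k (by omega)
    have h2 := hξc (k + 1) (by omega)
    push_cast at h2
    constructor <;> linarith
  have hmono : ∀ m, ∀ k, k < m → m ≤ 2 * K + 1 → ξ k < ξ m := by
    intro m
    induction m with
    | zero => intro k hk; omega
    | succ m ih =>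
      intro k hk hm
      have hg := (hgap m (by omega)).1
      rcases Nat.lt_succ_iff_lt_or_eq.1 hk with h | h
      · have := ih k h (by omega)
        linarith
      · subst h; linarith
  have hξ0 : ξ 0 = 0 := hfirst o rfl
  have hξN : ξ (2 * K + 1) = w := hlast o rfl
  have hξ0w : ∀ k ≤ 2 * K + 1, 0 ≤ ξ k ∧ ξ k ≤ w := by
    intro k hk
    constructor
    · rcases Nat.eq_zero_or_pos k with h | h
      · rw [h, hξ0]
      · have := hmono k 0 h hk
        linarith
    · rcases hk.eq_or_lt with h | h
      · rw [h, hξN]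
      · have := hmono _ k h le_rfl
        linarith
  -- a single height is dominated by the sum of the squares
  have hHk : ∀ k ≤ 2 * K + 1, H k ^ 2 ≤ 3 * K * h ^ 2 := by
    intro k hk
    rcases Nat.eq_zero_or_pos k with h' | h'
    · rw [h', hH0, zero_pow two_ne_zero]; positivity
    rcases hk.eq_or_lt with h'' | h''
    · rw [h'', hHN, zero_pow two_ne_zero]; positivity
    obtain ⟨m, rfl⟩ := Nat.exists_eq_add_of_le' h'
    refine le_trans ?_ hsum
    exact Finset.single_le_sum (f := fun k => H (k + 1) ^ 2) (fun _ _ => sq_nonneg _)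
      (Finset.mem_range.2 (by omega))
  have hbox : ∀ k ≤ 2 * K + 1, x (P k) ∈ boundingBox φ w W := by
    intro k hk j
    refine ⟨fun hj => ?_, fun hj => ?_⟩
    · have : j = o := Fin.ext hj
      rw [this]
      have := hξ0w k hk
      simp only [hξ] at this
      constructor <;> linarith
    · have h1 := (hcell k hk j).2 hj
      have h2 : H k ≤ √(W ^ 2 - w ^ 2) / 2 := by
        rw [le_div_iff₀ (by norm_num)]
        apply Real.le_sqrt_of_sq_le
        rw [hWsq]
        exact four_mul_sq_le hr hl1 hw hK' hz0 (by rw [← hhz]; nlinarith [sq_nonneg h]) (hHk k hk)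
      exact abs_le.1 (h1.trans h2)
  have hdist : ∀ k < 2 * K + 1, dist (x (P k)) (x (P (k + 1))) ^ 2
      ≤ (ξ (k + 1) - ξ k) ^ 2 + ((d : ℝ) - 1) * (H k + H (k + 1)) ^ 2 := by
    intro k hk
    rw [← φ.dist_map]
    exact dist_sq_le_of_coord (by omega) (fun j hj => (hcell k (by omega) j).2 hj)
      (fun j hj => (hcell (k + 1) (by omega) j).2 hj)
  have hadj : ∀ k < 2 * K + 1, dist (x (P k)) (x (P (k + 1))) ≤ r := by
    intro k hk
    have h1 := hdist k hk
    have h2 := hgap k hk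
    have h3 := hHr k (by omega)
    have h4 := hHr (k + 1) (by omega)
    -- The origin of the `7` in `imax`: an axial step of at most `3r/4` leaves `1 - 9/16 = 7/16` of
    -- `r²` for the transversal part, hence `7/64` for each height.
    have h5 : (ξ (k + 1) - ξ k) ^ 2 ≤ (3 / 4 * r) ^ 2 := by
      apply pow_le_pow_left₀ <;> linarith
    have h6 : ((d : ℝ) - 1) * (H k + H (k + 1)) ^ 2 ≤ 7 / 16 * r ^ 2 := by
      have : (H k + H (k + 1)) ^ 2 ≤ 2 * H k ^ 2 + 2 * H (k + 1) ^ 2 := by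
        nlinarith [sq_nonneg (H k - H (k + 1))]
      have := mul_le_mul_of_nonneg_left this (show 0 ≤ (d : ℝ) - 1 by linarith)
      linarith
    apply (pow_le_pow_iff_left₀ dist_nonneg hr.le two_ne_zero).1
    linarith
  have hlen : ∀ k < 2 * K + 1, dist (x (P k)) (x (P (k + 1)))
      ≤ (ξ (k + 1) - ξ k) + ((d : ℝ) - 1) * (H k + H (k + 1)) ^ 2 / (2 * l) := by
    intro k hk
    have h1 := hdist k hk
    have h2 := (hgap k hk).1
    set g := ξ (k + 1) - ξ k
    set y := ((d : ℝ) - 1) * (H k + H (k + 1)) ^ 2 with hy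
    have hy0 : 0 ≤ y := by positivity
    exact le_add_div_of_sq_le hl h2 hy0 dist_nonneg h1
  have hinj : ∀ k ≤ 2 * K + 1, ∀ m ≤ 2 * K + 1, P k = P m → k = m := by
    intro k hk m hm hkm
    have hx : ξ k = ξ m := by simp only [hξ, hkm]
    rcases lt_trichotomy k m with h | h | h
    · have := hmono m k h hm; linarith
    · exact h
    · have := hmono k m h hk; linarith
  let Q : ℕ → {k | x k ∈ boundingBox φ w W} := fun k =>
    if hk : k ≤ 2 * K + 1 then ⟨P k, hbox k hk⟩ else ⟨P 0, hbox 0 (by omega)⟩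
  have hQ : ∀ k ≤ 2 * K + 1, (Q k : Fin n) = P k := fun k hk => by simp [Q, hk]
  obtain ⟨p, hps, hpl⟩ := exists_walk_of_adj
    (G := (unitDiskGraph x r).induce {k | x k ∈ boundingBox φ w W}) (fun k => x k.1) Q (2 * K + 1)
    (by
      intro k hk
      rw [SimpleGraph.comap_adj]
      change (Q k : Fin n) ≠ Q (k + 1) ∧ dist (x (Q k)) (x (Q (k + 1))) ≤ r
      rw [hQ k (by omega), hQ (k + 1) (by omega)]
      refine ⟨fun h => ?_, hadj k hk⟩
      have := hinj k (by omega) (k + 1) (by omega) h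
      omega)
  have hQ0 : Q 0 = ⟨P 0, hbox 0 (by omega)⟩ := by simp [Q]
  have hQN : Q (2 * K + 1) = ⟨P (2 * K + 1), hbox _ le_rfl⟩ := by simp [Q]
  have hpath : p.IsPath := by
    rw [SimpleGraph.Walk.isPath_def, hps]
    apply List.Nodup.map_on _ List.nodup_range
    intro k hk m hm hkm
    rw [List.mem_range] at hk hm
    apply hinj k (by omega) m (by omega)
    rw [← hQ k (by omega), ← hQ m (by omega), hkm]
  have hlength : walkLength (fun k : {k | x k ∈ boundingBox φ w W} => x k.1) p ≤ W := by
    rw [hpl]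
    calc _ ≤ ∑ k ∈ Finset.range (2 * K + 1),
          ((ξ (k + 1) - ξ k) + ((d : ℝ) - 1) * (H k + H (k + 1)) ^ 2 / (2 * l)) := by
          apply Finset.sum_le_sum
          intro k hk
          rw [Finset.mem_range] at hk
          rw [hQ k (by omega), hQ (k + 1) (by omega)]
          exact hlen k hk
      _ = w + ((d : ℝ) - 1) / (2 * l) * ∑ k ∈ Finset.range (2 * K + 1), (H k + H (k + 1)) ^ 2 := by
          rw [Finset.sum_add_distrib, Finset.sum_range_sub, hξ0, hξN, sub_zero, Finset.mul_sum]
          congr 1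
          refine Finset.sum_congr rfl fun k _ => ?_
          ring
      _ ≤ w + ((d : ℝ) - 1) / (2 * l) * (4 * (3 * K * h ^ 2)) := by
          have := (sum_add_sq_le H (2 * K) hH0 hHN).trans
            (mul_le_mul_of_nonneg_left hsum (by norm_num))
          gcongr
      _ = w + 6 * K * z * r ^ 2 / l := by
          rw [mul_assoc (6 * (K : ℝ)), ← hhz]; field_simp; ring
      _ ≤ w * (1 + 100 * z) := by
          have : 6 * K * z * r ^ 2 / l ≤ w * (100 * z) := by
            rw [div_le_iff₀ hl, hw]
            exact excess_le hr hl1 (by positivity) hz0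
          linarith
      _ ≤ W := hWge
  refine ⟨hbox 0 (by omega), hbox _ le_rfl, p.copy hQ0 hQN, ?_, ?_⟩
  · simpa using hpath
  · simpa [walkLength] using hlength

/-! ### Sizes of the cells and calibration of the constants -/

theorem cellCount_mem {w r : ℝ} (hr : 0 < r) :
    1 ≤ cellCount w r ∧ cellLength w r ≤ r / 4 := by
  have hne : {K : ℕ | 1 ≤ K ∧ w / (4 * (K : ℝ) + 1) ≤ r / 4}.Nonempty := by
    refine ⟨⌈w / r⌉₊ + 1, by omega, ?_⟩
    have h := Nat.le_ceil (w / r)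
    rw [div_le_iff₀ hr] at h
    rw [div_le_iff₀ (by positivity)]
    push_cast
    nlinarith
  exact Nat.sInf_mem hne

theorem cellCount_le {w r : ℝ} (hr : 0 < r) (hw : r < w) : (cellCount w r : ℝ) ≤ w / r + 1 := by
  by_contra! hlt
  have h1 : 1 < w / r := (one_lt_div hr).2 hw
  have hK : 2 ≤ cellCount w r := by
    have : (2 : ℝ) < cellCount w r := by linarith
    exact_mod_cast this.le
  obtain ⟨K, hK'⟩ := Nat.exists_eq_add_of_le' hK
  have hnot : K + 1 ∉ {K : ℕ | 1 ≤ K ∧ w / (4 * (K : ℝ) + 1) ≤ r / 4} :=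
    Nat.notMem_of_lt_sInf (by change K + 1 < cellCount w r; omega)
  apply hnot
  refine ⟨by omega, ?_⟩
  rw [hK'] at hlt
  push_cast at hlt ⊢
  have : w / r * r = w := by field_simp
  rw [div_le_iff₀ (by positivity)]
  nlinarith

/-- If `K = 1` then `l = w/5 > r/5`. Otherwise `K - 1` violates the defining condition, so `l >
(r/4) (4K-3)/(4K+1)`, whose worst case `K = 2` is `5r/36`. -/
theorem le_cellLength {w r : ℝ} (hr : 0 < r) (hw : r < w) : 5 * r / 36 ≤ cellLength w r := by
  have hK := (cellCount_mem (w := w) hr).1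
  rw [cellLength]
  rcases hK.eq_or_lt with h | h
  · rw [← h]
    push_cast
    linarith
  · obtain ⟨K, hK'⟩ := Nat.exists_eq_add_of_le' (show 2 ≤ cellCount w r from h)
    have hnot : K + 1 ∉ {K : ℕ | 1 ≤ K ∧ w / (4 * (K : ℝ) + 1) ≤ r / 4} :=
      Nat.notMem_of_lt_sInf (by change K + 1 < cellCount w r; omega)
    have hlt : r / 4 < w / (4 * ((K : ℝ) + 1) + 1) := by
      by_contra! hle
      exact hnot ⟨by omega, by push_cast; exact hle⟩
    rw [hK']
    rw [lt_div_iff₀ (by positivity)] at hlt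
    rw [le_div_iff₀ (by positivity)]
    push_cast
    have : 0 ≤ (K : ℝ) * r := by positivity
    nlinarith

theorem eq_mul_cellLength (w r : ℝ) : w = (4 * cellCount w r + 1) * cellLength w r := by
  rw [cellLength]; field_simp

theorem pow_rpow_two_div {d : ℕ} (hd : 2 ≤ d) {y : ℝ} (hy : 0 ≤ y) :
    (y ^ (d - 1)) ^ (2 / ((d : ℝ) - 1)) = y ^ 2 := by
  have hd' : (2 : ℝ) ≤ d := by exact_mod_cast hd
  rw [← Real.rpow_natCast, ← Real.rpow_mul hy, Nat.cast_sub (by omega), ← Real.rpow_natCast]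
  congr 1
  have : (d : ℝ) - 1 ≠ 0 := by linarith
  push_cast
  field_simp

/-- The half-width of the cells, relative to the connectivity radius, at the maximal level. -/
noncomputable def maxWidth (d : ℕ) : ℝ := 1 / 8 * √(7 / ((d : ℝ) - 1))

theorem maxWidth_pos {d : ℕ} (hd : 2 ≤ d) : 0 < maxWidth d := by
  have hd' : (2 : ℝ) ≤ d := by exact_mod_cast hd
  have : 0 < (d : ℝ) - 1 := by linarith
  rw [maxWidth]
  positivity

theorem mul_maxWidth_sq {d : ℕ} (hd : 2 ≤ d) : ((d : ℝ) - 1) * maxWidth d ^ 2 = 7 / 64 := by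
  have hd' : (2 : ℝ) ≤ d := by exact_mod_cast hd
  have : 0 < (d : ℝ) - 1 := by linarith
  rw [maxWidth, mul_pow, Real.sq_sqrt (by positivity)]
  field_simp
  norm_num

/-- The constant in the definition of the levels. -/
noncomputable def levelConst (d : ℕ) : ℝ := 3 * maxWidth d ^ (d - 1) * (16 * d) ^ d

theorem levelConst_pos {d : ℕ} (hd : 2 ≤ d) : 0 < levelConst d := by
  have := maxWidth_pos hd
  rw [levelConst]
  positivity

theorem mul_imax_le {d n : ℕ} {c r w : ℝ} (hc : 0 < c) (h : 0 ≤ maxWidth d * r)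
    (hl : 0 ≤ cellLength w r) :
    c * imax c d n r w ≤ (maxWidth d * r) ^ (d - 1) * (n * cellLength w r) := by
  have := Nat.floor_le (a := 1 / c * (maxWidth d * r) ^ (d - 1) * (n * cellLength w r))
    (by positivity)
  change (imax c d n r w : ℝ) ≤ _ at this
  calc c * (imax c d n r w : ℝ)
      ≤ c * (1 / c * (maxWidth d * r) ^ (d - 1) * (n * cellLength w r)) := by gcongr
    _ = _ := by field_simp

/-- A cube of side `r / (16d)` fits in a cell of maximal width, both along the axis and across it.
-/
theorem sqrt_mul_le {d : ℕ} (hd : 2 ≤ d) {r : ℝ} (hr : 0 < r) :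
    2 * (√d * (r / (16 * d))) ≤ 5 * r / 36 ∧ √d * (r / (16 * d)) ≤ maxWidth d * r := by
  have hd' : (2 : ℝ) ≤ d := by exact_mod_cast hd
  have hsq : √(d : ℝ) * √d = d := Real.mul_self_sqrt (by positivity)
  have hs0 : 0 < √(d : ℝ) := by positivity
  have heq : √d * (r / (16 * d)) = r / 16 / √d := by
    field_simp
    nlinarith
  have hs1 : 4 / 3 ≤ √(d : ℝ) := by
    apply Real.le_sqrt_of_sq_le; norm_num; linarith
  have hmw : 1 ≤ 16 * maxWidth d * √d := by
    have h1 := mul_maxWidth_sq hd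
    have h2 := maxWidth_pos hd
    have h3 : 0 ≤ 16 * maxWidth d * √d := by positivity
    have h4 : (1 : ℝ) ^ 2 ≤ (16 * maxWidth d * √d) ^ 2 := by
      have : (16 * maxWidth d * √d) ^ 2 = 256 * (d * maxWidth d ^ 2) := by
        rw [mul_pow, mul_pow, Real.sq_sqrt (by positivity)]; ring
      rw [this]
      nlinarith [sq_nonneg (maxWidth d)]
    exact (pow_le_pow_iff_left₀ (by norm_num) h3 two_ne_zero).1 h4
  rw [heq]
  constructor
  · have : r / 16 / √d ≤ r / 16 / (4 / 3) := by gcongr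
    linarith
  · rw [div_le_iff₀ hs0]
    nlinarith

/-! ### The failure probability -/

theorem failProb_le {d n : ℕ} (hd : 2 ≤ d) (hn : 4 ≤ n) {r : ℝ} (hr : 0 < r) (hr1 : r < 1)
    {s t : Pt d} (hs : s ∈ unitCube d) (ht : t ∈ unitCube d) (hst : r < dist s t)
    {φ : Pt d ≃ᵃⁱ[ℝ] Pt d} (hφ : IsFrame φ s t) {u v : Fin n} (huv : u ≠ v)
    {i : ℕ} (hi : 1 ≤ i) (hi' : i ≤ imax (levelConst d) d n r (dist s t))
    (hcount : 2 * (cellCount (dist s t) r : ℝ)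
      ≤ Real.exp (imax (levelConst d) d n r (dist s t))) :
    failProb r u v s t φ (Wub (levelConst d) d n r (dist s t) i)
      ≤ ENNReal.ofReal (Real.exp (-i)) := by
  set c := levelConst d with hc
  set w := dist s t with hw
  set l := cellLength w r with hl
  set K := cellCount w r with hK
  set I := imax c d n r w with hI
  set b := maxWidth d with hb
  have hb0 : 0 < b := maxWidth_pos hd
  have hc0 : 0 < c := levelConst_pos hd
  have hw0 : 0 < w := hr.trans hst
  have hl1 : 5 * r / 36 ≤ l := le_cellLength hr hst
  have hl2 : l ≤ r / 4 := (cellCount_mem hr).2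
  have hl0 : 0 < l := by linarith
  have hK1 : 1 ≤ K := (cellCount_mem hr).1
  have hwl : w = (4 * K + 1) * l := eq_mul_cellLength w r
  have hd' : (2 : ℝ) ≤ d := by exact_mod_cast hd
  have hn' : (4 : ℝ) ≤ n := by exact_mod_cast hn
  have hn0 : (0 : ℝ) < n := by linarith
  have hi0 : (1 : ℝ) ≤ i := by exact_mod_cast hi
  have hd1 : d - 1 ≠ 0 := by omega
  have hcI : c * I ≤ (b * r) ^ (d - 1) * (n * l) := mul_imax_le hc0 (by positivity) hl0.le
  -- The top level: `i * m ≤ I` keeps `h m` below the maximal half-width `b * r`. As `M ≥ 1`,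
  -- rounding costs at most a factor `2`.
  set M := I / i with hM
  have hM1 : 1 ≤ M := (Nat.one_le_div_iff (by omega)).2 hi'
  have hiM : i * M ≤ I := Nat.mul_div_le I i
  have hIM : I ≤ 2 * (i * M) := by
    have h1 := Nat.div_add_mod I i
    have h2 := Nat.mod_lt I (show 0 < i by omega)
    have h3 : i ≤ i * M := Nat.le_mul_of_pos_right i hM1
    rw [← hM] at h1
    omega
  set h : ℕ → ℝ := fun m => (c * i * m / (n * l)) ^ (((d - 1 : ℕ) : ℝ)⁻¹) with hh
  have hh0 : ∀ m, 0 ≤ h m := fun m => by positivity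
  have hpow : ∀ m, h m ^ (d - 1) = c * i * m / (n * l) := fun m =>
    Real.rpow_inv_natCast_pow (by positivity) hd1
  have hhb : ∀ m ≤ M, h m ≤ b * r := by
    intro m hm
    apply (pow_le_pow_iff_left₀ (hh0 m) (by positivity) hd1).1
    rw [hpow, div_le_iff₀ (by positivity)]
    refine le_trans ?_ hcI
    rw [mul_assoc]
    have : i * m ≤ I := (Nat.mul_le_mul_left i hm).trans hiM
    have : (i : ℝ) * m ≤ I := by exact_mod_cast this
    gcongr
  -- The exponent `1/(d-1)` is at most `1`; so control of squared levels suffices in every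
  -- dimension.
  have hh1 : ∀ m, 1 ≤ m → h m ≤ h 1 * m := by
    intro m hm
    apply (pow_le_pow_iff_left₀ (hh0 m) (mul_nonneg (hh0 1) (by positivity)) hd1).1
    rw [mul_pow, hpow, hpow]
    have hm' : (1 : ℝ) ≤ m := by exact_mod_cast hm
    have : (m : ℝ) ≤ m ^ (d - 1) := le_self_pow₀ hm' hd1
    calc c * i * m / (n * l) = c * i / (n * l) * m := by ring
      _ ≤ c * i / (n * l) * m ^ (d - 1) := by gcongr
      _ = _ := by push_cast; ring
  -- The shift to `j + 1` leaves index `0` of the chain to `s`.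
  set D : ℕ → ℕ → Set (Pt d) := fun j m =>
    cell φ ((2 * ((j + 1 : ℕ) : ℝ) - 1) * l) (2 * ((j + 1 : ℕ) : ℝ) * l) (h m) with hD
  have hprob : ∀ j < 2 * K, ∀ m, 1 ≤ m → m ≤ M →
      vertexLaw u v s t (avoids u v (D j m)) ≤ ENNReal.ofReal (Real.exp (-(6 * i * m))) := by
    intro j hj m hm hmM
    have hm0 : (1 : ℝ) ≤ m := by exact_mod_cast hm
    set η := r / (16 * d) with hη
    have hη0 : 0 < η := by positivity
    have hη1 : η ≤ 1 / 2 := by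
      rw [hη, div_le_iff₀ (by positivity)]; linarith
    have hlo : 0 ≤ (2 * ((j + 1 : ℕ) : ℝ) - 1) * l := by
      apply mul_nonneg _ hl0.le
      push_cast
      have : (0 : ℝ) ≤ j := by positivity
      linarith
    have hhi : 2 * ((j + 1 : ℕ) : ℝ) * l ≤ w := by
      rw [hwl]
      have : ((j + 1 : ℕ) : ℝ) ≤ ((2 * K : ℕ) : ℝ) := by exact_mod_cast hj
      push_cast at this ⊢
      gcongr
      linarith
    obtain ⟨hη2, hη3⟩ := sqrt_mul_le hd hr
    set a := h m / (b * r) with ha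
    have ha0 : 0 ≤ a := by have := hh0 m; positivity
    have ha1 : a ≤ 1 := div_le_one_of_le₀ (hhb m hmM) (by positivity)
    have hvol1 := ofReal_pow_le_volume_inter_cell hs ht hφ hw0 hlo hhi hη0.le hη1
      (by linarith) hη3
    have hvol2 := volume_inter_cell_mul_le (by omega) hs ht hφ hw0 (h := b * r) hlo hhi ha0 ha1
    have hab : a * (b * r) = h m := by rw [ha]; field_simp
    rw [hab] at hvol2
    have hp : ENNReal.ofReal (a ^ (d - 1) * η ^ d) ≤ uniformCube d (D j m) := by
      rw [uniformCube_apply, ENNReal.ofReal_mul (by positivity)]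
      exact le_trans (by gcongr) hvol2
    refine (vertexLaw_avoids_le u v huv s t (measurableSet_cell _ _ _ _) (by positivity) hp).trans ?_
    apply ENNReal.ofReal_le_ofReal
    apply Real.exp_le_exp.2
    apply neg_le_neg
    -- `levelConst` is chosen for this cancellation. Then `n - 2 ≥ n/2` and `r ≥ 4l` turn the `3`
    -- into the exponent `6im`.
    have hval : a ^ (d - 1) * η ^ d = 3 * i * m * r / (n * l) := by
      rw [ha, div_pow, hpow, hη, div_pow, hc, levelConst, ← hb, mul_pow b r]
      have hrd : r ^ d = r ^ (d - 1) * r := by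
        rw [← pow_succ]; congr 1; omega
      rw [hrd]
      field_simp
    rw [hval]
    have hn2 : (n : ℝ) / 2 ≤ n - 2 := by linarith
    calc 6 * (i : ℝ) * m = n / 2 * (3 * i * m * (4 * l) / (n * l)) := by field_simp; norm_num
      _ ≤ (n - 2) * (3 * i * m * r / (n * l)) := by
          gcongr <;> linarith
  -- With `2K ≤ exp I` and `I ≤ 2iM` the exponent is at most `I - 3I = -2I ≤ -i - 1`.
  have hJ : ((2 * K : ℕ) : ℝ) * Real.exp (-(6 * i * M)) ≤ Real.exp (-i) / 2 := by
    have hI1 : (1 : ℝ) ≤ I := by exact_mod_cast hi.trans hi'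
    have hiI : (i : ℝ) ≤ I := by exact_mod_cast hi'
    have hIM' : (I : ℝ) ≤ 2 * (i * M) := by exact_mod_cast hIM
    push_cast
    calc 2 * (K : ℝ) * Real.exp (-(6 * i * M)) ≤ Real.exp I * Real.exp (-(6 * i * M)) := by gcongr
      _ = Real.exp (I + -(6 * i * M)) := (Real.exp_add _ _).symm
      _ ≤ Real.exp (-i + -1) := by apply Real.exp_le_exp.2; nlinarith
      _ = Real.exp (-i) * Real.exp (-1) := Real.exp_add _ _
      _ ≤ Real.exp (-i) * (1 / 2) := by
          gcongr
          rw [Real.exp_neg, ← one_div]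
          apply one_div_le_one_div_of_le (by norm_num)
          have := Real.add_one_le_exp 1
          linarith
      _ = _ := by ring
  have hmain := measure_not_exists_levels_le (vertexLaw u v s t) (2 * K) M i hi hM1
    (fun j m => avoids u v (D j m)) (fun j m => measurableSet_avoids u v (measurableSet_cell _ _ _ _))
    hprob hJ
  set E := {x : Fin n → Pt d | ¬ ∃ L : ℕ → ℕ,
    (∀ j < 2 * K, 1 ≤ L j ∧ L j ≤ M ∧ x ∉ avoids u v (D j (L j))) ∧
      2 * ∑ j ∈ Finset.range (2 * K), L j ^ 2 ≤ 3 * (2 * K)} with hE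
  have hsub : {x | ¬ HasShortPath x r (boundingBox φ w (Wub c d n r w i)) u v (Wub c d n r w i)} ⊆
      ({x | x u ≠ s} ∪ {x | x v ≠ t}) ∪ E := by
    intro x hx
    by_contra hcon
    apply hx
    simp only [hE, Set.mem_union, not_or, Set.mem_ofPred_eq, not_not] at hcon
    obtain ⟨⟨hxu, hxv⟩, L, hL, hLsum⟩ := hcon
    have hq : ∀ j, ∃ k, j < 2 * K → x k ∈ D j (L j) := by
      intro j
      by_cases hj : j < 2 * K
      · have := (hL j hj).2.2
        simp only [avoids, Set.mem_ofPred_eq, not_forall, not_not] at this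
        obtain ⟨k, _, _, hk⟩ := this
        exact ⟨k, fun _ => hk⟩
      · exact ⟨u, fun h => absurd h hj⟩
    choose q hq using hq
    let P : ℕ → Fin n := fun k => if k = 0 then u else if k = 2 * K + 1 then v else q (k - 1)
    let H : ℕ → ℝ := fun k => if k = 0 then 0 else if k = 2 * K + 1 then 0 else h (L (k - 1))
    have hHsucc : ∀ j < 2 * K, H (j + 1) = h (L j) := by
      intro j hj
      simp only [H]
      rw [if_neg (by omega), if_neg (by omega), Nat.add_sub_cancel]
    have hPsucc : ∀ j < 2 * K, P (j + 1) = q j := by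
      intro j hj
      simp only [P]
      rw [if_neg (by omega), if_neg (by omega), Nat.add_sub_cancel]
    have hP0 : P 0 = u := by simp [P]
    have hPN : P (2 * K + 1) = v := by simp [P]
    have hH0 : H 0 = 0 := by simp [H]
    have hHN : H (2 * K + 1) = 0 := by simp [H]
    have hcases : ∀ k ≤ 2 * K + 1, k = 0 ∨ k = 2 * K + 1 ∨ ∃ j < 2 * K, k = j + 1 := by
      intro k hk
      rcases k with _ | j
      · exact Or.inl rfl
      · by_cases hj : j < 2 * K
        · exact Or.inr (Or.inr ⟨j, hj, rfl⟩)
        · exact Or.inr (Or.inl (by omega))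
    have hbr : ∀ y, 0 ≤ y → y ≤ b * r → ((d : ℝ) - 1) * y ^ 2 ≤ 7 / 64 * r ^ 2 := by
      intro y hy0 hy
      calc ((d : ℝ) - 1) * y ^ 2 ≤ ((d : ℝ) - 1) * (b * r) ^ 2 := by
            gcongr
            linarith
        _ = _ := by rw [mul_pow, ← mul_assoc, mul_maxWidth_sq hd]
    have hres := hasShortPath_of_chain (x := x) (r := r) (l := l) (h := h 1) (w := w)
      (W := Wub c d n r w i) (φ := φ) (K := K) hd P H hK1 hr hl1 hl2 hwl ?_ ?_ ?_ ?_ ?_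
      hH0 hHN ?_ ?_
    · rwa [hP0, hPN] at hres
    -- The quantity inside `Wub` is the half-width of level `1` in disguise.
    · have hbase : c * i / (n * cellLength w r * r ^ (d - 1)) = (h 1 / r) ^ (d - 1) := by
        rw [div_pow, hpow, ← hl]
        push_cast
        field_simp
      rw [Wub, hbase, pow_rpow_two_div hd (div_nonneg (hh0 1) hr.le)]
      congr 3
      ring
    · have := hbr (h 1) (hh0 1) (hhb 1 hM1)
      rw [div_pow, mul_div_assoc', div_le_iff₀ (by positivity)]
      exact this
    · intro k hk
      rcases hcases k hk with rfl | rfl | ⟨j, hj, rfl⟩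
      · rw [hP0, hxu, hH0]
        intro j
        rw [hφ.1]
        simp [hl0.le]
      · rw [hPN, hxv, hHN]
        intro j
        rw [hφ.2]
        refine ⟨fun hj => ?_, fun hj => ?_⟩
        · rw [if_pos hj, ← hw, hwl]
          push_cast
          constructor <;> nlinarith
        · rw [if_neg hj]; simp
      · rw [hPsucc j hj, hHsucc j hj]
        exact hq j hj
    · intro j _
      rw [hP0, hxu, hφ.1]; rfl
    · intro j hj
      rw [hPN, hxv, hφ.2, if_pos hj]
    · intro k hk
      rcases hcases k hk with rfl | rfl | ⟨j, hj, rfl⟩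
      · rw [hH0]; exact hbr 0 le_rfl (by positivity)
      · rw [hHN]; exact hbr 0 le_rfl (by positivity)
      · rw [hHsucc j hj]
        exact hbr _ (hh0 _) (hhb _ (hL j hj).2.1)
    · have hLs : 2 * ∑ j ∈ Finset.range (2 * K), (L j : ℝ) ^ 2 ≤ 3 * (2 * K) := by
        exact_mod_cast hLsum
      calc ∑ k ∈ Finset.range (2 * K), H (k + 1) ^ 2
          ≤ ∑ k ∈ Finset.range (2 * K), h 1 ^ 2 * (L k : ℝ) ^ 2 := by
            apply Finset.sum_le_sum
            intro k hk
            have hk' := Finset.mem_range.1 hk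
            rw [hHsucc k hk', ← mul_pow]
            have := hh1 (L k) (hL k hk').1
            have := hh0 (L k)
            gcongr
        _ = h 1 ^ 2 * ∑ k ∈ Finset.range (2 * K), (L k : ℝ) ^ 2 := by rw [Finset.mul_sum]
        _ ≤ h 1 ^ 2 * (3 * K) := by
            gcongr
            linarith
        _ = _ := by ring
  calc failProb r u v s t φ (Wub c d n r w i)
      ≤ vertexLaw u v s t (({x | x u ≠ s} ∪ {x | x v ≠ t}) ∪ E) := measure_mono hsub
    _ ≤ (vertexLaw u v s t {x | x u ≠ s} + vertexLaw u v s t {x | x v ≠ t})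
        + vertexLaw u v s t E :=
      (measure_union_le _ _).trans (add_le_add_left (measure_union_le _ _) _)
    _ = vertexLaw u v s t E := by
        rw [vertexLaw_ne_left, vertexLaw_ne_right u v huv, add_zero, zero_add]
    _ ≤ _ := hmain

/-! ### Orders of magnitude and choice of the constants -/

theorem dist_le_of_mem_unitCube {d : ℕ} {s t : Pt d} (hs : s ∈ unitCube d) (ht : t ∈ unitCube d) :
    dist s t ≤ d := by
  rw [EuclideanSpace.dist_eq]
  apply Real.sqrt_le_iff.2 ⟨by positivity, ?_⟩
  calc ∑ j, dist (s j) (t j) ^ 2 ≤ ∑ _j : Fin d, (1 : ℝ) := by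
        apply Finset.sum_le_sum
        intro j _
        have h1 := hs j
        have h2 := ht j
        rw [sq_le_one_iff₀ dist_nonneg, Real.dist_eq, abs_le]
        constructor <;> linarith
    _ = (d : ℝ) := by simp
    _ ≤ (d : ℝ) ^ 2 := by exact_mod_cast Nat.le_self_pow two_ne_zero d

theorem mul_sqrt_one_add_le {a Q y : ℝ} (ha : 0 ≤ a) (ha1 : a ≤ 1) (haQ : a ≤ Q) (hy : 0 ≤ y) :
    a * √(1 + y) ≤ √(1 + Q * y) := by
  apply Real.le_sqrt_of_sq_le
  rw [mul_pow, Real.sq_sqrt (by positivity)]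
  have h1 : a ^ 2 ≤ a := by nlinarith
  have h2 : a * y ≤ Q * y := by gcongr
  nlinarith

theorem sqrt_one_add_le_mul {A Q y : ℝ} (hA1 : 1 ≤ A) (hAQ : Q ≤ A) (hy : 0 ≤ y) :
    √(1 + Q * y) ≤ A * √(1 + y) := by
  apply Real.sqrt_le_iff.2 ⟨by positivity, ?_⟩
  rw [mul_pow, Real.sq_sqrt (by positivity)]
  have h1 : A ≤ A ^ 2 := by nlinarith
  have h2 : Q * y ≤ A * y := by gcongr
  nlinarith

theorem Wub_eq {d n : ℕ} (hd : 2 ≤ d) (hn : 0 < n) {c r w : ℝ} (hc : 0 ≤ c) (hr : 0 < r)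
    (hl : 0 < cellLength w r) (i : ℕ) :
    Wub c d n r w i = w * √(1 + 40 ^ 2 * ((d : ℝ) - 1) *
      (c * (r / cellLength w r)) ^ (2 / ((d : ℝ) - 1)) *
        ((i : ℝ) / (n * r ^ d)) ^ (2 / ((d : ℝ) - 1))) := by
  have hn' : (0 : ℝ) < n := by exact_mod_cast hn
  have hrd : r ^ d = r ^ (d - 1) * r := by
    rw [← pow_succ]; congr 1; omega
  rw [Wub, mul_assoc _ (_ ^ _) (_ ^ _), ← Real.mul_rpow (by positivity) (by positivity)]
  congr 5
  rw [hrd]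
  field_simp

/-- At the maximal width the radicand is `1 + 1600 * 7/64 = 176 < 14²`. -/
theorem Wub_le_of_le_imax {d n : ℕ} (hd : 2 ≤ d) (hn : 0 < n) {c r w : ℝ} (hc : 0 < c) (hr : 0 < r)
    (hw : 0 ≤ w) (hl : 0 < cellLength w r) {i : ℕ} (hi : i ≤ imax c d n r w) :
    Wub c d n r w i ≤ 14 * w := by
  have hn' : (0 : ℝ) < n := by exact_mod_cast hn
  have hd' : (2 : ℝ) ≤ d := by exact_mod_cast hd
  have hb := maxWidth_pos hd
  have h1 := mul_imax_le (n := n) hc (mul_nonneg hb.le hr.le) hl.le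
  have hi' : (i : ℝ) ≤ imax c d n r w := by exact_mod_cast hi
  have h2 : c * i / (n * cellLength w r * r ^ (d - 1)) ≤ maxWidth d ^ (d - 1) := by
    rw [div_le_iff₀ (by positivity)]
    calc c * i ≤ c * imax c d n r w := by gcongr
      _ ≤ _ := h1
      _ = _ := by rw [mul_pow]; ring
  have h3 : (c * i / (n * cellLength w r * r ^ (d - 1))) ^ (2 / ((d : ℝ) - 1)) ≤ maxWidth d ^ 2 := by
    rw [← pow_rpow_two_div hd hb.le]
    apply Real.rpow_le_rpow (by positivity) h2
    apply div_nonneg (by norm_num)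
    linarith
  rw [Wub, mul_comm]
  apply mul_le_mul_of_nonneg_right _ hw
  apply Real.sqrt_le_iff.2 ⟨by norm_num, ?_⟩
  have h4 := mul_le_mul_of_nonneg_left h3 (show 0 ≤ (d : ℝ) - 1 by linarith)
  rw [mul_maxWidth_sq hd] at h4
  nlinarith

/-- Since `l` is comparable to `r`, only the floor matters; `hlarge` lets half of the lower bound
`5/36` absorb the loss of `1`. -/
theorem imax_bounds {d n : ℕ} (hd : 2 ≤ d) {c r w : ℝ} (hc : 0 < c) (hr : 0 < r)
    (hl1 : 5 * r / 36 ≤ cellLength w r) (hl2 : cellLength w r ≤ r / 4)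
    (hlarge : 1 ≤ 5 / 72 * (maxWidth d ^ (d - 1) / c) * (n * r ^ d)) :
    5 / 72 * (maxWidth d ^ (d - 1) / c) * (n * r ^ d) ≤ imax c d n r w ∧
      (imax c d n r w : ℝ) ≤ maxWidth d ^ (d - 1) / c * (n * r ^ d) := by
  have hb := maxWidth_pos hd
  have hrd : r ^ d = r ^ (d - 1) * r := by
    rw [← pow_succ]; congr 1; omega
  set l := cellLength w r with hl
  have hl0 : 0 < l := by linarith
  have himax : imax c d n r w = ⌊1 / c * (maxWidth d * r) ^ (d - 1) * (n * l)⌋₊ := rfl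
  set X := 1 / c * (maxWidth d * r) ^ (d - 1) * (n * l) with hX
  have hXeq : X = maxWidth d ^ (d - 1) / c * (n * r ^ (d - 1)) * l := by
    rw [hX, mul_pow]; ring
  set T := maxWidth d ^ (d - 1) / c * (n * r ^ (d - 1)) with hT
  have hT0 : 0 ≤ T := by positivity
  have hTr : maxWidth d ^ (d - 1) / c * (n * r ^ d) = T * r := by rw [hT, hrd]; ring
  have h1 : T * (5 * r / 36) ≤ X := by rw [hXeq]; gcongr
  have h2 : X ≤ T * (r / 4) := by rw [hXeq]; gcongr
  rw [mul_assoc, hTr] at hlarge ⊢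
  rw [himax]
  constructor
  · have := Nat.lt_floor_add_one X
    linarith
  · have := Nat.floor_le (a := X) (by positivity)
    have : 0 ≤ T * r := by positivity
    linarith

/-- From `1/r ≤ n` there are at most `4dn ≤ n ^ (4d+1)` cells. -/
theorem two_mul_cellCount_le_exp {d n : ℕ} (hd : 2 ≤ d) (hn : 2 ≤ n) {r w y : ℝ} (hr : 0 < r)
    (hr1 : r < 1) (hw : r < w) (hwd : w ≤ d) (hnr : 1 ≤ n * r ^ d)
    (hy : (4 * d + 1) * Real.log n ≤ y) : 2 * (cellCount w r : ℝ) ≤ Real.exp y := by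
  have hd' : (2 : ℝ) ≤ d := by exact_mod_cast hd
  have hn' : (2 : ℝ) ≤ n := by exact_mod_cast hn
  have hn0 : (0 : ℝ) < n := by linarith
  have h1 : 1 / r ≤ n := by
    rw [div_le_iff₀ hr]
    have : r ^ d ≤ r := pow_le_of_le_one hr.le hr1.le (by omega)
    exact hnr.trans (by gcongr)
  have h2 := cellCount_le hr hw
  have h3 : w / r ≤ d * n := by
    rw [div_eq_mul_one_div]
    gcongr
  have h4 : (4 : ℝ) * d ≤ n ^ (4 * d) := by
    have h5 : (4 * d : ℕ) < 2 ^ (4 * d) := Nat.lt_two_pow_self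
    have h6 : ((4 * d : ℕ) : ℝ) ≤ 2 ^ (4 * d) := by exact_mod_cast h5.le
    push_cast at h6
    exact h6.trans (by gcongr)
  calc 2 * (cellCount w r : ℝ) ≤ 4 * d * n := by nlinarith
    _ ≤ n ^ (4 * d) * n := by gcongr
    _ = n ^ (4 * d + 1) := (pow_succ _ _).symm
    _ = Real.exp ((4 * d + 1) * Real.log n) := by
        have h7 := Real.exp_nat_mul (Real.log n) (4 * d + 1)
        rw [Real.exp_log hn0] at h7
        rw [← h7]
        push_cast
        rfl
    _ ≤ Real.exp y := Real.exp_le_exp.2 hy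

end UnitDisk

theorem mainTheorem4 (d : ℕ) (hd : 2 ≤ d) :
    ∃ β c a A : ℝ, 1 < β ∧ 0 < c ∧ 0 < a ∧ 0 < A ∧
      ∀ (n : ℕ) (r : ℝ), 2 ≤ n → 0 < r → r < 1 →
        (β * Real.log n / n) ^ (1 / (d : ℝ)) ≤ r →
      ∀ s ∈ UnitDisk.unitCube d, ∀ t ∈ UnitDisk.unitCube d, r < dist s t →
        (a * (n * r ^ d) ≤ (UnitDisk.imax c d n r (dist s t) : ℝ) ∧
          (UnitDisk.imax c d n r (dist s t) : ℝ) ≤ A * (n * r ^ d)) ∧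
        (∀ i : ℕ, 1 ≤ i →
          a * (dist s t * √(1 + ((i : ℝ) / (n * r ^ d)) ^ (2 / ((d : ℝ) - 1))))
              ≤ UnitDisk.Wub c d n r (dist s t) i ∧
          UnitDisk.Wub c d n r (dist s t) i
              ≤ A * (dist s t * √(1 + ((i : ℝ) / (n * r ^ d)) ^ (2 / ((d : ℝ) - 1))))) ∧
        (∀ i : ℕ, 1 ≤ i → i ≤ UnitDisk.imax c d n r (dist s t) →
          UnitDisk.Wub c d n r (dist s t) i ≤ A * dist s t) ∧
        ∀ φ : UnitDisk.Pt d ≃ᵃⁱ[ℝ] UnitDisk.Pt d, UnitDisk.IsFrame φ s t →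
        ∀ u v : Fin n, u ≠ v →
        ∀ i : ℕ, 1 ≤ i → i ≤ UnitDisk.imax c d n r (dist s t) →
          UnitDisk.failProb r u v s t φ (UnitDisk.Wub c d n r (dist s t) i)
            ≤ ENNReal.ofReal (Real.exp (-(i : ℝ))) := by
  have hd' : (2 : ℝ) ≤ d := by exact_mod_cast hd
  have hb := UnitDisk.maxWidth_pos hd
  have hc := UnitDisk.levelConst_pos hd
  set b := UnitDisk.maxWidth d with hbdef
  set c := UnitDisk.levelConst d with hcdef
  set e : ℝ := 2 / ((d : ℝ) - 1) with he
  have hd1 : 0 < (d : ℝ) - 1 := by linarith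
  have he0 : 0 ≤ e := by positivity
  set g : ℝ := b ^ (d - 1) / c with hg
  have hg0 : 0 < g := by positivity
  -- `Q₁` and `Q₂` come from the extreme values `4` and `36/5` of `r / l`.
  set Q₁ : ℝ := 40 ^ 2 * ((d : ℝ) - 1) * (c * 4) ^ e with hQ₁
  set Q₂ : ℝ := 40 ^ 2 * ((d : ℝ) - 1) * (c * (36 / 5)) ^ e with hQ₂
  have hQ₁0 : 0 < Q₁ := by positivity
  have hQ₂0 : 0 < Q₂ := by positivity
  -- The `6` forces `n * r ^ d ≥ 4`, hence `n ≥ 4`; the other term forces `imax ≥ (4d+1) log n`.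
  set β : ℝ := 6 + (4 * d + 1) / (5 / 72 * g) with hβ
  refine ⟨β, c, min (5 / 72 * g) (min 1 Q₁), 14 + g + Q₂, ?_, hc, by positivity, by positivity, ?_⟩
  · have : 0 < (4 * (d : ℝ) + 1) / (5 / 72 * g) := by positivity
    linarith
  intro n r hn hr hr1 hβr s hs t ht hst
  have hn' : (2 : ℝ) ≤ n := by exact_mod_cast hn
  have hn0 : (0 : ℝ) < n := by linarith
  have hβ6 : 6 ≤ β := by
    have : 0 < (4 * (d : ℝ) + 1) / (5 / 72 * g) := by positivity
    linarith
  have hβg : 4 * (d : ℝ) + 1 ≤ 5 / 72 * g * β := by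
    have : 5 / 72 * g * ((4 * (d : ℝ) + 1) / (5 / 72 * g)) = 4 * d + 1 := by field_simp
    rw [hβ, mul_add, this]
    have : 0 < 5 / 72 * g * 6 := by positivity
    linarith
  have hlog : 0.69 ≤ Real.log n := by
    have h1 := Real.log_two_gt_d9
    have h2 := Real.log_le_log (by norm_num) hn'
    linarith
  have hβn : β * Real.log n ≤ n * r ^ d := by
    have h0 : 0 ≤ β * Real.log n / n := by positivity
    have h1 : (β * Real.log n / n : ℝ) ≤ r ^ d := by
      have h2 := pow_le_pow_left₀ (Real.rpow_nonneg h0 _) hβr d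
      rwa [one_div, Real.rpow_inv_natCast_pow h0 (by omega)] at h2
    rw [div_le_iff₀ hn0] at h1
    linarith
  have hnr : 4 ≤ n * r ^ d := by nlinarith
  have hn4 : 4 ≤ n := by
    have h1 : r ^ d ≤ 1 := pow_le_one₀ hr.le hr1.le
    have h2 : (4 : ℝ) ≤ n := by nlinarith
    exact_mod_cast h2
  have hgn : (4 * d + 1) * Real.log n ≤ 5 / 72 * g * (n * r ^ d) := by
    calc (4 * d + 1) * Real.log n ≤ 5 / 72 * g * β * Real.log n := by gcongr
      _ = 5 / 72 * g * (β * Real.log n) := by ring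
      _ ≤ _ := by gcongr
  have hw0 : 0 < dist s t := hr.trans hst
  have hl1 := UnitDisk.le_cellLength hr hst
  have hl2 := (UnitDisk.cellCount_mem (w := dist s t) hr).2
  have hl0 : 0 < UnitDisk.cellLength (dist s t) r := by linarith
  have himax := UnitDisk.imax_bounds (n := n) (w := dist s t) hd hc hr hl1 hl2 (by nlinarith)
  refine ⟨⟨le_trans ?_ himax.1, himax.2.trans ?_⟩, fun i hi => ?_, fun i hi hi' => ?_, ?_⟩
  · gcongr
    exact min_le_left _ _
  · gcongr
    linarith
  · rw [UnitDisk.Wub_eq hd (by omega) hc.le hr hl0]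
    set y := ((i : ℝ) / (n * r ^ d)) ^ e with hy
    have hy0 : 0 ≤ y := by positivity
    have hρ1 : 4 ≤ r / UnitDisk.cellLength (dist s t) r := by
      rw [le_div_iff₀ hl0]; linarith
    have hρ2 : r / UnitDisk.cellLength (dist s t) r ≤ 36 / 5 := by
      rw [div_le_iff₀ hl0]; linarith
    set Q := 40 ^ 2 * ((d : ℝ) - 1) * (c * (r / UnitDisk.cellLength (dist s t) r)) ^ e with hQ
    have hQ1 : Q₁ ≤ Q := by rw [hQ₁, hQ]; gcongr
    have hQ2 : Q ≤ Q₂ := by rw [hQ₂, hQ]; gcongr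
    constructor
    · rw [mul_left_comm]
      gcongr
      exact UnitDisk.mul_sqrt_one_add_le (by positivity) ((min_le_right _ _).trans (min_le_left _ _))
        (((min_le_right _ _).trans (min_le_right _ _)).trans hQ1) hy0
    · rw [mul_left_comm (14 + g + Q₂)]
      gcongr
      exact UnitDisk.sqrt_one_add_le_mul (by linarith) (by linarith) hy0
  · refine (UnitDisk.Wub_le_of_le_imax hd (by omega) hc hr hw0.le hl0 hi').trans ?_
    gcongr
    linarith
  · intro φ hφ u v huv i hi hi'
    exact UnitDisk.failProb_le hd hn4 hr hr1 hs ht hst hφ huv hi hi'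
      (UnitDisk.two_mul_cellCount_le_exp hd hn hr hr1 hst (UnitDisk.dist_le_of_mem_unitCube hs ht)
        (by linarith) (hgn.trans himax.1))
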